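/- Let $\{X_t\}_{t\ge1}$ be a sequence of positive, identically distributed random variables which are pairwise asymptotically independent: $P[X_t>x]>0$ for all $x>0$, and for all $s\ne t$, $$\lim_{x\to\infty}\frac{P[X_s>x,\,X_t>x]}{P[X_s>x]}=\lim_{x\to\infty}\frac{P[X_s>x,\,X_t>x]}{P[X_t>x]}=0 .$$ Let $\{\Theta_t\}_{t\ge1}$ be a sequence of positive random variables, on the same probability space, such that the sequence $\{\Theta_t\}$ is independent of the sequence $\{X_t\}$. Let $\alpha>0$ and assume the RW condition for $\alpha$, that is, for some $\epsilon\in(0,\alpha)$, $$\sum_{t=1}^\infty E\big[\Theta_t^{\alpha+\epsilon}+\Theta_t^{\alpha-\epsilon}\big]<\infty\quad\text{if }0<\alpha<1,\qquad \sum_{t=1}^\infty \Big(E\big[\Theta_t^{\alpha+\epsilon}+\Theta_t^{\alpha-\epsilon}\big]\Big)^{\frac1{\alpha+\epsilon}}<\infty\quad\text{if }\alpha\ge1 .$$ Put $X_{(\infty)}=\sum_{t=1}^\infty\Theta_tX_t\in[0,\infty]$ and $R(x)=\sum_{t=1}^\infty P[\Theta_tX_t>x]\in[0,\infty]$. Suppose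 that $R$ is regularly varying of index $-\alpha$, that is, $0<R(x)<\infty$ for all large $x$ and $\lim_{x\to\infty}R(ux)/R(x)=u^{-\alpha}$ for every $u>0$. Then $$\sum_{t=1}^\infty P[\Theta_tX_t>x]\sim P[X_{(\infty)}>x]\qquad\text{as }x\to\infty,$$ that is, both sides are positive and finite for all large $x$ and their ratio tends to $1$, and $X_{(\infty)}$ is finite with probability one. -/

import Mathlib

open MeasureTheory ProbabilityTheory Filter Topology
open scoped ENNReal

/-- `f` is regularly varying (at infinity) of index `ρ`: it is positive and finite for all large
arguments and `f (t * x) / f x → t ^ ρ` as `x → ∞`, for every `t > 0`. -/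
def IsRegularlyVarying (f : ℝ → ℝ≥0∞) (ρ : ℝ) : Prop :=
  (∀ᶠ x in atTop, 0 < f x ∧ f x < ∞) ∧
    ∀ t : ℝ, 0 < t → Tendsto (fun x : ℝ => f (t * x) / f x) atTop (𝓝 (ENNReal.ofReal (t ^ ρ)))

/-- `f x ∼ g x` as `x → ∞`: both functions are positive and finite for all large arguments and
their ratio tends to `1`. -/
def TailEquivalent (f g : ℝ → ℝ≥0∞) : Prop :=
  (∀ᶠ x in atTop, (0 < f x ∧ f x < ∞) ∧ (0 < g x ∧ g x < ∞)) ∧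
    Tendsto (fun x : ℝ => f x / g x) atTop (𝓝 1)

/-- Asymptotic independence of two real random variables (the tails of both have to be positive
everywhere): `P[Y > x, Z > x]` is negligible with respect to both tails. -/
def AsymptoticallyIndependent {Ω : Type*} [MeasurableSpace Ω] (μ : Measure Ω) (Y Z : Ω → ℝ) :
    Prop :=
  (∀ x : ℝ, 0 < x → 0 < μ {ω | x < Y ω} ∧ 0 < μ {ω | x < Z ω}) ∧
    Tendsto (fun x : ℝ => μ {ω | x < Y ω ∧ x < Z ω} / μ {ω | x < Y ω}) atTop (𝓝 0) ∧
    Tendsto (fun x : ℝ => μ {ω | x < Y ω ∧ x < Z ω} / μ {ω | x < Z ω}) atTop (𝓝 0)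

/-- The RW (Resnick–Willekens) moment conditions on the weights, for the index `α`. -/
def RWCondition {Ω : Type*} [MeasurableSpace Ω] (μ : Measure Ω) (Θ : ℕ → Ω → ℝ) (α : ℝ) : Prop :=
  (α < 1 → ∃ ε : ℝ, 0 < ε ∧ ε < α ∧
    ∑' t, ∫⁻ ω, ENNReal.ofReal (Θ t ω ^ (α + ε) + Θ t ω ^ (α - ε)) ∂μ < ∞) ∧
  (1 ≤ α → ∃ ε : ℝ, 0 < ε ∧ ε < α ∧
    ∑' t, (∫⁻ ω, ENNReal.ofReal (Θ t ω ^ (α + ε) + Θ t ω ^ (α - ε)) ∂μ) ^ (1 / (α + ε)) < ∞)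

/-- The randomly weighted series `∑ Θ_t X_t` of (almost surely) positive terms, as a random
variable with values in `[0, ∞]`. -/
noncomputable def weightedSeries {Ω : Type*} (Θ X : ℕ → Ω → ℝ) (ω : Ω) : ℝ≥0∞ :=
  ∑' t, ENNReal.ofReal (Θ t ω * X t ω)

/-- The sum of the tails of the weighted terms, `x ↦ ∑ P[Θ_t X_t > x]`, with values in `[0, ∞]`. -/
noncomputable def tailSum {Ω : Type*} [MeasurableSpace Ω] (μ : Measure Ω) (Θ X : ℕ → Ω → ℝ)
    (x : ℝ) : ℝ≥0∞ :=
  ∑' t, μ {ω | x < Θ t ω * X t ω}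

/-! This is the principle of a single big jump, with every error measured in units of `R x`. The
common tail `F` of the `X t` need not be regularly varying. However, `Θ 0` exceeds some `c > 0` with
positive probability, so `F x` is at most a constant times `R (c * x)`, hence eventually at most a
constant times `R x`. Potter's bounds for `R` then give `F (x / v) ≤ C * R x * (v ^ (α + ε) + v ^ (α
- ε))` for every `v > 0`. Integrating over the weight bounds `P[Θ t * X t > x]` by `C * R x * w t`,
where `w t` is the moment in the RW condition.

Three consequences follow. Joint exceedances are `o(R)`: bounded weights reduce them to asymptotic
independence of the `X t`, and large weights carry little of the moment integral. The tail of the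
remainder series is at most a small multiple of `R`: truncate its terms at level `x`, then apply
Markov and Minkowski in `L^p` with `p > α + ε` if `α ≥ 1`, and with `p = 1` if `α < 1`. The
remainder of the sum of tails is small for the same reason.

For the upper bound, a large sum forces one term above `(1 - 2 * δ) * x`, two moderately large
terms, or a large remainder (`lt_tsum_trichotomy`); then let `δ → 0`. For the lower bound, one large
term suffices, and Bonferroni's inequality compares the union with the sum of tails. -/

namespace IsRegularlyVarying

/-! ### Regular variation and Potter bounds. -/

variable {R : ℝ → ℝ≥0∞} {ρ : ℝ}

lemma eventually_le_mul (h : IsRegularlyVarying R ρ) {t : ℝ} (ht : 0 < t) {a : ℝ≥0∞}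
    (ha : ENNReal.ofReal (t ^ ρ) < a) : ∀ᶠ x in atTop, R (t * x) ≤ a * R x := by
  filter_upwards [h.1, (h.2 t ht).eventually (gt_mem_nhds ha)] with x hx hlt
  exact (ENNReal.div_le_iff hx.1.ne' hx.2.ne).1 hlt.le

lemma eventually_mul_le (h : IsRegularlyVarying R ρ) {t : ℝ} (ht : 0 < t) {a : ℝ≥0∞}
    (ha : a < ENNReal.ofReal (t ^ ρ)) : ∀ᶠ x in atTop, a * R x ≤ R (t * x) := by
  filter_upwards [h.1, (h.2 t ht).eventually (lt_mem_nhds ha)] with x hx hlt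
  exact (ENNReal.le_div_iff_mul_le (Or.inl hx.1.ne') (Or.inl hx.2.ne)).1 hlt.le

/-- Potter's bounds for a nonincreasing regularly varying function. -/
lemma potter {α ε : ℝ} (h : IsRegularlyVarying R (-α)) (hanti : Antitone R) (hε : 0 < ε)
    (hεα : ε < α) :
    ∃ x₀ : ℝ, 0 < x₀ ∧ ∀ x v : ℝ, 0 < v → x₀ ≤ x → x₀ ≤ x / v →
      R (x / v) ≤ ENNReal.ofReal (2 ^ (α + ε)) *
        ENNReal.ofReal (v ^ (α + ε) + v ^ (α - ε)) * R x := by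
  have h1 : ∀ᶠ x in atTop, R (2 * x) ≤ ENNReal.ofReal (2 ^ (-(α - ε))) * R x :=
    h.eventually_le_mul two_pos ((ENNReal.ofReal_lt_ofReal_iff (by positivity)).2
      (Real.rpow_lt_rpow_of_exponent_lt one_lt_two (by linarith)))
  have h2 : ∀ᶠ x in atTop, R x ≤ ENNReal.ofReal (2 ^ (α + ε)) * R (2 * x) := by
    filter_upwards [h.eventually_mul_le two_pos (a := ENNReal.ofReal (2 ^ (-(α + ε))))
      ((ENNReal.ofReal_lt_ofReal_iff (by positivity)).2
      (Real.rpow_lt_rpow_of_exponent_lt one_lt_two (by linarith)))] with x hx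
    calc R x = ENNReal.ofReal (2 ^ (α + ε)) * (ENNReal.ofReal (2 ^ (-(α + ε))) * R x) := by
          rw [← mul_assoc, ← ENNReal.ofReal_mul (by positivity), ← Real.rpow_add two_pos]
          simp
      _ ≤ _ := by gcongr
  obtain ⟨x₁, hx₁⟩ := eventually_atTop.1 (h1.and h2)
  -- Iterate the two doubling bounds. The 1 in the threshold makes `y` positive, so `2 ^ n * y`
  -- stays beyond `x₁`.
  have iter : ∀ (n : ℕ) (y : ℝ), max x₁ 1 ≤ y →
      R (2 ^ n * y) ≤ ENNReal.ofReal (((2 : ℝ) ^ n) ^ (-(α - ε))) * R y ∧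
      R y ≤ ENNReal.ofReal (((2 : ℝ) ^ n) ^ (α + ε)) * R (2 ^ n * y) := by
    intro n
    induction n with
    | zero => intro y _; simp
    | succ n ih =>
      intro y hy
      have hy1 : 1 ≤ y := (le_max_right _ _).trans hy
      have hpow : (1 : ℝ) ≤ 2 ^ n := one_le_pow₀ (by norm_num)
      have hy' : x₁ ≤ 2 ^ n * y := by nlinarith [(le_max_left x₁ 1).trans hy]
      obtain ⟨ha, hb⟩ := hx₁ _ hy'
      obtain ⟨ia, ib⟩ := ih y hy
      have e : (2 : ℝ) ^ (n + 1) * y = 2 * (2 ^ n * y) := by ring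
      have e2 : ∀ s : ℝ, ENNReal.ofReal (((2 : ℝ) ^ (n + 1)) ^ s)
          = ENNReal.ofReal (((2 : ℝ) ^ n) ^ s) * ENNReal.ofReal (2 ^ s) := fun s => by
        rw [pow_succ, Real.mul_rpow (by positivity) (by positivity),
          ENNReal.ofReal_mul (by positivity)]
      rw [e, e2, e2]
      constructor
      · calc _ ≤ _ := ha
          _ ≤ ENNReal.ofReal (2 ^ (-(α - ε))) *
            (ENNReal.ofReal (((2 : ℝ) ^ n) ^ (-(α - ε))) * R y) := by gcongr
          _ = _ := by ring
      · calc _ ≤ _ := ib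
          _ ≤ ENNReal.ofReal (((2 : ℝ) ^ n) ^ (α + ε)) *
            (ENNReal.ofReal (2 ^ (α + ε)) * R (2 * (2 ^ n * y))) := by gcongr
          _ = _ := by ring
  refine ⟨max x₁ 1, by positivity, fun x v hv hx hxv => ?_⟩
  have hx0 : 0 < x := lt_of_lt_of_le (by positivity) hx
  rw [← ENNReal.ofReal_mul (by positivity)]
  rcases le_or_gt v 1 with hv1 | hv1
  · obtain ⟨n, hn1, hn2⟩ := exists_nat_pow_near ((one_le_inv₀ hv).2 hv1) one_lt_two
    calc R (x / v) ≤ R (2 ^ n * x) := hanti (by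
          rw [div_eq_inv_mul]; gcongr)
      _ ≤ ENNReal.ofReal (((2 : ℝ) ^ n) ^ (-(α - ε))) * R x := (iter n x hx).1
      _ ≤ _ := by
        gcongr
        have : (2 * v)⁻¹ ≤ 2 ^ n := by
          rw [mul_inv, inv_mul_le_iff₀ two_pos]
          exact hn2.le.trans_eq (by ring)
        calc ((2 : ℝ) ^ n) ^ (-(α - ε)) ≤ ((2 * v)⁻¹) ^ (-(α - ε)) :=
              Real.rpow_le_rpow_of_nonpos (by positivity) this (by linarith)
          _ = 2 ^ (α - ε) * v ^ (α - ε) := by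
              rw [Real.inv_rpow (by positivity), Real.rpow_neg (by positivity), inv_inv,
                Real.mul_rpow two_pos.le hv.le]
          _ ≤ 2 ^ (α + ε) * (v ^ (α + ε) + v ^ (α - ε)) := by
              gcongr
              · norm_num
              · linarith
              · exact le_add_of_nonneg_left (by positivity)
  -- Here the doubling starts from `x / v`; `n + 1` steps are needed to get past `x`, and the
  -- overshoot by at most 2 costs the factor `2 ^ (α + ε)`.
  · obtain ⟨n, hn1, hn2⟩ := exists_nat_pow_near hv1.le one_lt_two
    calc R (x / v) ≤ ENNReal.ofReal (((2 : ℝ) ^ (n + 1)) ^ (α + ε)) * R (2 ^ (n + 1) * (x / v)) :=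
          (iter (n + 1) _ hxv).2
      _ ≤ _ := by
        gcongr
        · calc ((2 : ℝ) ^ (n + 1)) ^ (α + ε) ≤ (2 * v) ^ (α + ε) := by
                have : (2 : ℝ) ^ (n + 1) ≤ 2 * v := by rw [pow_succ']; gcongr
                gcongr
                linarith
            _ = 2 ^ (α + ε) * v ^ (α + ε) := Real.mul_rpow two_pos.le hv.le
            _ ≤ _ := by
              gcongr
              exact le_add_of_nonneg_right (by positivity)
        · apply hanti
          rw [mul_div_assoc', le_div_iff₀ hv, mul_comm]
          gcongr

/-- A nonincreasing `[0, 1]`-valued function dominated by a nonincreasing regularly varying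
function satisfies a Potter bound without restriction on the scaling factor. -/
lemma potter_of_le {α ε : ℝ} (h : IsRegularlyVarying R (-α)) (hanti : Antitone R) (hε : 0 < ε)
    (hεα : ε < α) {F : ℝ → ℝ≥0∞} (hF1 : ∀ x, F x ≤ 1) {K : ℝ≥0∞} (hK : K ≠ ∞)
    (hFR : ∀ᶠ x in atTop, F x ≤ K * R x) :
    ∃ C : ℝ≥0∞, C ≠ ∞ ∧ ∃ x₁ : ℝ, 0 < x₁ ∧ ∀ x v : ℝ, 0 < v → x₁ ≤ x →
      F (x / v) ≤ C * R x * ENNReal.ofReal (v ^ (α + ε) + v ^ (α - ε)) := by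
  obtain ⟨x₀, hx₀, hp⟩ := h.potter hanti hε hεα
  obtain ⟨x₂, hx₂⟩ := eventually_atTop.1 (hFR.and h.1)
  set x₁ := max x₀ x₂ with hx₁
  have hpos : 0 < x₁ := lt_of_lt_of_le hx₀ (le_max_left _ _)
  set D := ENNReal.ofReal ((2 : ℝ) ^ (α + ε)) with hD
  obtain ⟨-, hR1, hR2⟩ := hx₂ x₁ (le_max_right _ _)
  have hC : (K + (R x₁)⁻¹) * D ≠ ∞ :=
    ENNReal.mul_ne_top (ENNReal.add_ne_top.2 ⟨hK, ENNReal.inv_ne_top.2 hR1.ne'⟩)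
      ENNReal.ofReal_ne_top
  refine ⟨(K + (R x₁)⁻¹) * D, hC, x₁, hpos, fun x v hv hx => ?_⟩
  rcases le_or_gt x₁ (x / v) with hxv | hxv
  · calc F (x / v) ≤ K * R (x / v) := (hx₂ _ ((le_max_right _ _).trans hxv)).1
      _ ≤ (K + (R x₁)⁻¹) * (D * ENNReal.ofReal (v ^ (α + ε) + v ^ (α - ε)) * R x) := by
        gcongr
        · exact le_self_add
        · exact hp x v hv ((le_max_left _ _).trans hx) ((le_max_left _ _).trans hxv)
      _ = _ := by ring
  -- Below the threshold only `F ≤ 1` is available. Potter at `v = x / x₁` bounds the constant `R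
  -- x₁` by a multiple of `R x`, and the actual `v` is larger still.
  · have hx0 : 0 < x := hpos.trans_le hx
    have hV : 0 < x / x₁ := by positivity
    have hVv : x / x₁ ≤ v := by
      rw [div_lt_iff₀ hv] at hxv
      rw [div_le_iff₀ hpos]; linarith
    have e : x / (x / x₁) = x₁ := by field_simp
    have := hp x (x / x₁) hV ((le_max_left _ _).trans hx) (by rw [e]; exact le_max_left _ _)
    rw [e] at this
    calc F (x / v) ≤ 1 := hF1 _
      _ = (R x₁)⁻¹ * R x₁ := (ENNReal.inv_mul_cancel hR1.ne' hR2.ne).symm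
      _ ≤ (K + (R x₁)⁻¹) * (D * ENNReal.ofReal (v ^ (α + ε) + v ^ (α - ε)) * R x) := by
        gcongr
        · exact le_add_self
        · refine this.trans ?_
          gcongr
          · linarith
      _ = _ := by ring

/-- A nonzero finite limit would force `R (2 * x) / R x → 1`, whereas the limit is `2 ^ (-α) < 1`.
-/
lemma tendsto_zero {α : ℝ} (h : IsRegularlyVarying R (-α)) (hanti : Antitone R) (hα : 0 < α) :
    Tendsto R atTop (𝓝 0) := by
  obtain ⟨x₀, hx₀⟩ := eventually_atTop.1 h.1
  have hlim := tendsto_atTop_iInf hanti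
  set L := ⨅ x, R x
  by_cases hL : L = 0
  · rwa [hL] at hlim
  exfalso
  have hLtop : L ≠ ∞ := ((iInf_le R x₀).trans_lt (hx₀ x₀ le_rfl).2).ne
  have h2 : Tendsto (fun x => R (2 * x)) atTop (𝓝 L) :=
    hlim.comp (tendsto_id.const_mul_atTop two_pos)
  have h3 := ENNReal.Tendsto.div h2 (Or.inl hL) hlim (Or.inl hLtop)
  rw [ENNReal.div_self hL hLtop] at h3
  have h4 := tendsto_nhds_unique h3 (h.2 2 two_pos)
  have h5 : (2 : ℝ) ^ (-α) < 1 := Real.rpow_lt_one_of_one_lt_of_neg one_lt_two (by linarith)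
  have h6 : ENNReal.ofReal ((2 : ℝ) ^ (-α)) < 1 := by
    rw [← ENNReal.ofReal_one]; exact (ENNReal.ofReal_lt_ofReal_iff one_pos).2 h5
  exact h6.ne h4.symm

end IsRegularlyVarying

/-! ### Deterministic inequalities for series. -/

section Series

/-- If at most one of the first `m` terms exceeds `δ * x / m`, the others total at most `δ * x`.
With a remainder of at most `δ * x`, the exceptional term must supply the rest. -/
lemma lt_tsum_trichotomy {a : ℕ → ℝ≥0∞} {x δ : ℝ} {m : ℕ} (hm : 0 < m) (hx : 0 < x) (hδ : 0 < δ)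
    (hδ' : δ < 1 / 2) (h : ENNReal.ofReal x < ∑' t, a t) :
    (∃ t < m, ENNReal.ofReal ((1 - 2 * δ) * x) < a t) ∨
      (∃ t < m, ∃ s < t, ENNReal.ofReal (δ / m * x) < a s ∧ ENNReal.ofReal (δ / m * x) < a t) ∨
      ENNReal.ofReal (δ * x) < ∑' t, a (t + m) := by
  by_contra! hc
  obtain ⟨h1, h2, h3⟩ := hc
  set κ := ENNReal.ofReal (δ / m * x) with hκ
  have key : ∃ s < m, ∀ t < m, t ≠ s → a t ≤ κ := by
    by_cases hs : ∃ s < m, κ < a s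
    · obtain ⟨s, hsm, hs⟩ := hs
      refine ⟨s, hsm, fun t ht hts => ?_⟩
      by_contra! hlt
      rcases lt_or_gt_of_ne hts with hl | hl
      · exact (h2 s hsm t hl hlt).not_gt hs
      · exact (h2 t ht s hl hs).not_gt hlt
    · push Not at hs
      exact ⟨0, hm, fun t ht _ => hs t ht⟩
  obtain ⟨s, hsm, hs⟩ := key
  have hsum : ∑ t ∈ Finset.range m, a t ≤ ENNReal.ofReal ((1 - 2 * δ) * x) + m * κ := by
    rw [← Finset.add_sum_erase _ _ (Finset.mem_range.2 hsm)]
    gcongr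
    · exact h1 s hsm
    · calc ∑ t ∈ (Finset.range m).erase s, a t ≤ ((Finset.range m).erase s).card • κ :=
            Finset.sum_le_card_nsmul _ _ _ fun t ht => hs t
              (Finset.mem_range.1 (Finset.mem_of_mem_erase ht)) (Finset.ne_of_mem_erase ht)
        _ ≤ m * κ := by
            rw [nsmul_eq_mul]
            gcongr
            simpa using Finset.card_erase_le (s := Finset.range m) (a := s)
  have hmκ : m * κ = ENNReal.ofReal (δ * x) := by
    rw [hκ, ← ENNReal.ofReal_natCast, ← ENNReal.ofReal_mul (by positivity)]
    congr 1
    field_simp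
  refine h.not_ge ?_
  rw [← ENNReal.summable.sum_add_tsum_nat_add' (k := m)]
  calc _ ≤ ENNReal.ofReal ((1 - 2 * δ) * x) + ENNReal.ofReal (δ * x) + ENNReal.ofReal (δ * x) := by
        rw [← hmκ]
        rw [← hmκ] at h3
        gcongr
    _ = ENNReal.ofReal x := by
        have := mul_pos hδ hx
        rw [← ENNReal.ofReal_add (by nlinarith) this.le, ← ENNReal.ofReal_add (by nlinarith) this.le]
        congr 1
        ring

lemma ENNReal.tsum_rpow_le_rpow_tsum {ι : Type*} (b : ι → ℝ≥0∞) {p : ℝ} (hp : 1 ≤ p) :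
    ∑' t, b t ^ p ≤ (∑' t, b t) ^ p := by
  have e : ∀ c : ℝ≥0∞, c ^ p = c * c ^ (p - 1) := fun c => by
    conv_rhs => rw [← ENNReal.rpow_one c, ← ENNReal.rpow_mul, one_mul]
    rw [← ENNReal.rpow_add_of_nonneg _ _ zero_le_one (by linarith)]
    congr 1; ring
  rw [e (∑' t, b t), ← ENNReal.tsum_mul_right]
  refine ENNReal.tsum_le_tsum fun t => ?_
  rw [e (b t)]
  gcongr
  exact ENNReal.le_tsum t

/-- A single term `≥ x` already contributes 1; otherwise truncation removes nothing from the terms.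
Truncation makes `p`-th moments usable although `p` exceeds the tail exponent. -/
lemma one_le_tsum_truncated {y : ℕ → ℝ} {x : ℝ} (hx : 0 < x)
    (h : ENNReal.ofReal x < ∑' t, ENNReal.ofReal (y t)) :
    1 ≤ ∑' t, ENNReal.ofReal (max 0 (min (y t / x) 1)) := by
  by_cases hy : ∃ t, x ≤ y t
  · obtain ⟨t, ht⟩ := hy
    refine le_trans ?_ (ENNReal.le_tsum t)
    rw [min_eq_right ((one_le_div hx).2 ht), max_eq_right zero_le_one, ENNReal.ofReal_one]
  · push Not at hy
    have e : ∀ t, ENNReal.ofReal (max 0 (min (y t / x) 1))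
        = ENNReal.ofReal (y t) * (ENNReal.ofReal x)⁻¹ := fun t => by
      rw [min_eq_left ((div_le_one hx).2 (hy t).le), ← div_eq_mul_inv,
        ← ENNReal.ofReal_div_of_pos hx, ENNReal.ofReal_max, ENNReal.ofReal_zero, max_eq_right]
      exact zero_le
    simp_rw [e]
    rw [ENNReal.tsum_mul_right, ← div_eq_mul_inv,
      ENNReal.le_div_iff_mul_le (Or.inl (by simpa using hx)) (Or.inl ENNReal.ofReal_ne_top), one_mul]
    exact h.le

end Series

/-! ### Moment and measure inequalities. -/

section Integrals

variable {Ω : Type*} [MeasurableSpace Ω] {μ : Measure Ω}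

/-- Minkowski's inequality for countable sums of `[0, ∞]`-valued functions. -/
lemma lintegral_tsum_rpow_le {f : ℕ → Ω → ℝ≥0∞} (hf : ∀ t, Measurable (f t)) {p : ℝ}
    (hp : 1 ≤ p) :
    ∫⁻ ω, (∑' t, f t ω) ^ p ∂μ ≤ (∑' t, (∫⁻ ω, f t ω ^ p ∂μ) ^ (1 / p)) ^ p := by
  have hp0 : 0 < p := by linarith
  have hfin : ∀ n : ℕ, ∫⁻ ω, (∑ t ∈ Finset.range n, f t ω) ^ p ∂μ
      ≤ (∑' t, (∫⁻ ω, f t ω ^ p ∂μ) ^ (1 / p)) ^ p := fun n => by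
    have := eLpNorm'_sum_le (μ := μ) (f := f) (s := Finset.range n) (q := p)
      (fun i _ => (hf i).aestronglyMeasurable) hp
    simp only [eLpNorm', enorm_eq_self, Finset.sum_apply] at this
    calc _ = ((∫⁻ ω, (∑ t ∈ Finset.range n, f t ω) ^ p ∂μ) ^ (1 / p)) ^ p := by
          rw [← ENNReal.rpow_mul, one_div_mul_cancel hp0.ne', ENNReal.rpow_one]
      _ ≤ _ := by
          gcongr
          exact this.trans (ENNReal.sum_le_tsum _)
  have hlim := lintegral_tendsto_of_tendsto_of_monotone (μ := μ)
    (f := fun n ω => (∑ t ∈ Finset.range n, f t ω) ^ p) (F := fun ω => (∑' t, f t ω) ^ p)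
    (fun n => ((Finset.measurable_fun_sum _ fun i _ => hf i).pow_const p).aemeasurable)
    (ae_of_all _ fun ω i j hij => by
      dsimp only
      gcongr)
    (ae_of_all _ fun ω => ((ENNReal.continuous_rpow_const).tendsto _).comp
      (ENNReal.tendsto_nat_tsum fun t => f t ω))
  exact le_of_tendsto' hlim hfin

/-- Layer-cake formula: truncation at 1 confines `z` to `(0, 1)`, so the tail bound is needed only
there. The resulting integral is finite when `β < p`. -/
lemma lintegral_truncated_rpow_le {Y : Ω → ℝ} (hY : Measurable Y) {p β : ℝ} (hp : 1 ≤ p)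
    {x : ℝ} (hx : 0 < x) {M : ℝ≥0∞}
    (h : ∀ z : ℝ, 0 < z → z < 1 → μ {ω | x * z < Y ω} ≤ M * ENNReal.ofReal (z ^ (-β))) :
    ∫⁻ ω, ENNReal.ofReal (max 0 (min (Y ω / x) 1)) ^ p ∂μ ≤
      ENNReal.ofReal p * (∫⁻ z in Set.Ioo (0 : ℝ) 1, ENNReal.ofReal (z ^ (p - 1 - β))) * M := by
  have hp0 : 0 < p := by linarith
  simp_rw [ENNReal.ofReal_rpow_of_nonneg (le_max_left _ _) hp0.le]
  rw [lintegral_rpow_eq_lintegral_meas_lt_mul (f := fun ω => max 0 (min (Y ω / x) 1)) μ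
    (ae_of_all _ fun ω => le_max_left _ _) (by fun_prop) hp0, mul_assoc]
  gcongr
  rw [← lintegral_mul_const _ (by fun_prop),
    ← lintegral_indicator measurableSet_Ioi, ← lintegral_indicator measurableSet_Ioo]
  refine lintegral_mono fun z => ?_
  by_cases hz0 : 0 < z
  swap
  · simp [hz0]
  rw [Set.indicator_of_mem (by exact hz0)]
  rcases lt_or_ge z 1 with hz1 | hz1
  · rw [Set.indicator_of_mem (by exact ⟨hz0, hz1⟩)]
    have e : {ω | z < max 0 (min (Y ω / x) 1)} = {ω | x * z < Y ω} := by
      ext ω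
      simp only [Set.mem_ofPred_eq, lt_max_iff, lt_min_iff, hz1, and_true, hz0.not_gt, false_or]
      rw [lt_div_iff₀ hx, mul_comm]
    rw [e]
    calc _ ≤ M * ENNReal.ofReal (z ^ (-β)) * ENNReal.ofReal (z ^ (p - 1)) := by
          gcongr; exact h z hz0 hz1
      _ = _ := by
          rw [mul_assoc, ← ENNReal.ofReal_mul (by positivity), ← Real.rpow_add hz0, mul_comm]
          congr 3; ring
  · have e : {ω | z < max 0 (min (Y ω / x) 1)} = ∅ := by
      ext ω
      simp only [Set.mem_ofPred_eq, lt_max_iff, lt_min_iff, hz1.not_gt, and_false, hz0.not_gt,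
        or_self, Set.mem_empty_iff_false]
    rw [e]
    simp

lemma lintegral_Ioo_rpow_ne_top {r : ℝ} (hr : -1 < r) :
    ∫⁻ z in Set.Ioo (0 : ℝ) 1, ENNReal.ofReal (z ^ r) ≠ ∞ := by
  have h := (intervalIntegral.intervalIntegrable_rpow' (a := 0) (b := 1) hr)
  rw [intervalIntegrable_iff_integrableOn_Ioo_of_le zero_le_one] at h
  exact (Integrable.lintegral_lt_top h).ne

/-- The probability that a product of two independent variables, the first one positive, is large
while the first one lies in a given set. -/
lemma measure_mem_and_lt_mul [IsFiniteMeasure μ] {T X : Ω → ℝ} (hT : Measurable T)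
    (hX : Measurable X) (hTpos : ∀ᵐ ω ∂μ, 0 < T ω) (hTX : IndepFun T X μ) {B : Set ℝ}
    (hB : MeasurableSet B) (x : ℝ) :
    μ {ω | T ω ∈ B ∧ x < T ω * X ω} = ∫⁻ ω in T ⁻¹' B, μ {ω' | x / T ω < X ω'} ∂μ := by
  have hS : MeasurableSet {q : ℝ × ℝ | q.1 ∈ B ∧ x < q.1 * q.2} :=
    (measurable_fst hB).inter (measurableSet_lt measurable_const (measurable_fst.mul measurable_snd))
  have h1 : μ {ω | T ω ∈ B ∧ x < T ω * X ω}
      = (μ.map fun ω => (T ω, X ω)) {q : ℝ × ℝ | q.1 ∈ B ∧ x < q.1 * q.2} := by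
    rw [Measure.map_apply (hT.prodMk hX) hS]; rfl
  rw [h1, (indepFun_iff_map_prod_eq_prod_map_map hT.aemeasurable hX.aemeasurable).1 hTX,
    Measure.prod_apply hS, lintegral_map (measurable_measure_prodMk_left hS) hT,
    ← lintegral_indicator (hT hB)]
  refine lintegral_congr_ae ?_
  filter_upwards [hTpos] with ω hω
  rw [Measure.map_apply hX (measurable_prodMk_left hS)]
  by_cases hB' : T ω ∈ B
  · rw [Set.indicator_of_mem (by exact hB')]
    congr 1
    ext ω'
    simp [hB', div_lt_iff₀ hω, mul_comm]
  · rw [Set.indicator_of_notMem (by exact hB')]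
    simp [hB']

/-- Bonferroni's inequality. -/
lemma sum_measure_le_measure_iUnion_add {A : ℕ → Set Ω} (hA : ∀ t, MeasurableSet (A t)) (m : ℕ) :
    ∑ t ∈ Finset.range m, μ (A t) ≤ μ (⋃ t ∈ Finset.range m, A t) +
      ∑ t ∈ Finset.range m, ∑ s ∈ Finset.range t, μ (A s ∩ A t) := by
  induction m with
  | zero => simp
  | succ m ih =>
    rw [Finset.sum_range_succ, Finset.sum_range_succ]
    set U := ⋃ t ∈ Finset.range m, A t with hU
    have hU' : (⋃ t ∈ Finset.range (m + 1), A t) = U ∪ A m := by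
      rw [Finset.range_add_one, Finset.set_biUnion_insert, Set.union_comm]
    have hUA : μ (U ∩ A m) ≤ ∑ s ∈ Finset.range m, μ (A s ∩ A m) := by
      rw [hU, Set.iUnion₂_inter]
      exact measure_biUnion_finset_le _ _
    rw [hU']
    calc _ ≤ μ U + (∑ t ∈ Finset.range m, ∑ s ∈ Finset.range t, μ (A s ∩ A t)) + μ (A m) := by
          gcongr
      _ = μ (U ∪ A m) + μ (U ∩ A m)
          + ∑ t ∈ Finset.range m, ∑ s ∈ Finset.range t, μ (A s ∩ A t) := by
          rw [measure_union_add_inter _ (hA m)]; ring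
      _ ≤ μ (U ∪ A m) + (∑ s ∈ Finset.range m, μ (A s ∩ A m))
          + ∑ t ∈ Finset.range m, ∑ s ∈ Finset.range t, μ (A s ∩ A t) := by gcongr
      _ = _ := by ring

end Integrals

/-! ### Negligible functions and comparison of tails. -/

/-- `f` is negligible with respect to `R` at infinity. -/
def Negligible (f R : ℝ → ℝ≥0∞) : Prop :=
  ∀ η : ℝ≥0∞, 0 < η → ∀ᶠ x in atTop, f x ≤ η * R x

namespace Negligible

lemma finset_sum {ι : Type*} {S : Finset ι} {f : ι → ℝ → ℝ≥0∞} {R : ℝ → ℝ≥0∞}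
    (h : ∀ i ∈ S, Negligible (f i) R) : Negligible (fun x => ∑ i ∈ S, f i x) R := by
  classical
  induction S using Finset.induction_on with
  | empty => intro η _; simp
  | insert a S ha ih =>
    intro η hη
    have hη2 : 0 < η / 2 := ENNReal.half_pos hη.ne'
    filter_upwards [h a (Finset.mem_insert_self a S) _ hη2,
      ih (fun i hi => h i (Finset.mem_insert_of_mem hi)) _ hη2] with x h1 h2
    rw [Finset.sum_insert ha]
    calc _ ≤ η / 2 * R x + η / 2 * R x := add_le_add h1 h2
      _ = η * R x := by rw [← add_mul, ENNReal.add_halves]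

end Negligible

namespace IsRegularlyVarying

variable {R : ℝ → ℝ≥0∞} {ρ : ℝ}

/-- The tolerance `η'` comes before `f` because the remainder to which this is applied starts at an
index `m` that depends on `η'`. -/
lemma eventually_comp_mul_le (h : IsRegularlyVarying R ρ) {κ : ℝ} (hκ : 0 < κ) {η : ℝ≥0∞}
    (hη : 0 < η) : ∃ η' : ℝ≥0∞, 0 < η' ∧ ∀ f : ℝ → ℝ≥0∞,
      (∀ᶠ x in atTop, f x ≤ η' * R x) → ∀ᶠ x in atTop, f (κ * x) ≤ η * R x := by
  set D := ENNReal.ofReal (κ ^ ρ) + 1 with hD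
  have hDtop : D ≠ ∞ := by simp [hD]
  have hD0 : D ≠ 0 := by simp [hD]
  refine ⟨η / D, ENNReal.div_pos hη.ne' hDtop, fun f hf => ?_⟩
  have h1 : ENNReal.ofReal (κ ^ ρ) < D := ENNReal.lt_add_right ENNReal.ofReal_ne_top one_ne_zero
  filter_upwards [h.eventually_le_mul hκ h1,
    (tendsto_id.const_mul_atTop hκ).eventually hf] with x h2 h3
  calc f (κ * x) ≤ η / D * R (κ * x) := h3
    _ ≤ η / D * (D * R x) := by gcongr
    _ = η * R x := by rw [← mul_assoc, ENNReal.div_mul_cancel hD0 hDtop]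

lemma negligible_comp_mul (h : IsRegularlyVarying R ρ) {κ : ℝ} (hκ : 0 < κ) {f : ℝ → ℝ≥0∞}
    (hf : Negligible f R) : Negligible (fun x => f (κ * x)) R := fun _ hη => by
  obtain ⟨η', hη', hf'⟩ := h.eventually_comp_mul_le hκ hη
  exact hf' f (hf η' hη')

end IsRegularlyVarying

lemma tailEquivalent_of_le {f g : ℝ → ℝ≥0∞} (hf : ∀ᶠ x in atTop, 0 < f x ∧ f x < ∞)
    (hg : ∀ x, g x < ∞) (hle : ∀ η : ℝ≥0∞, 0 < η → ∀ᶠ x in atTop, g x ≤ (1 + η) * f x)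
    (hge : ∀ η : ℝ≥0∞, 0 < η → ∀ᶠ x in atTop, f x ≤ g x + η * f x) : TailEquivalent f g := by
  refine ⟨?_, ?_⟩
  -- With `η = 1 / 2`, `g x = 0` would give `f x ≤ f x / 2`; this is where positivity of `g` comes
  -- from.
  · filter_upwards [hf, hge (1 / 2) (by simp)] with x hx hx'
    refine ⟨hx, pos_iff_ne_zero.2 fun h0 => ?_, hg x⟩
    rw [h0, zero_add, one_div, mul_comm, ← div_eq_mul_inv] at hx'
    exact (ENNReal.half_lt_self hx.1.ne' hx.2.ne).not_ge hx'
  · have h1 : Tendsto (fun x => g x / f x) atTop (𝓝 1) := by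
      rw [ENNReal.tendsto_nhds ENNReal.one_ne_top]
      intro η hη
      filter_upwards [hf, hle η hη, hge η hη] with x hx h2 h3
      refine ⟨?_, (ENNReal.div_le_iff hx.1.ne' hx.2.ne).2 h2⟩
      rw [tsub_le_iff_right]
      calc (1 : ℝ≥0∞) = f x / f x := (ENNReal.div_self hx.1.ne' hx.2.ne).symm
        _ ≤ (g x + η * f x) / f x := by gcongr
        _ = g x / f x + η := by
          rw [ENNReal.add_div, ENNReal.mul_div_cancel_right hx.1.ne' hx.2.ne]
    have h2 := h1.inv
    rw [inv_one] at h2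
    refine h2.congr' ?_
    filter_upwards [hf] with x hx
    exact ENNReal.inv_div (Or.inl hx.2.ne) (Or.inl hx.1.ne')

/-! ### The single big jump: upper and lower bounds. -/

section SumOfTails

variable {Ω : Type*} [MeasurableSpace Ω] {μ : Measure Ω} {Y : ℕ → Ω → ℝ} {α : ℝ}

/-- The principle of a single big jump: if the tail sum of the series is regularly varying, joint
exceedances are negligible, and so are the remainders of the series, then the tail of the
series is asymptotically at most the sum of the tails. -/
lemma eventually_measure_tsum_le (hreg : IsRegularlyVarying (fun x => ∑' t, μ {ω | x < Y t ω}) (-α))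
    (hpair : ∀ s t, s ≠ t → Negligible (fun x => μ {ω | x < Y s ω ∧ x < Y t ω})
      (fun x => ∑' t, μ {ω | x < Y t ω}))
    (htail : ∀ η : ℝ≥0∞, 0 < η → ∃ m : ℕ, 0 < m ∧ ∀ᶠ x in atTop,
      μ {ω | ENNReal.ofReal x < ∑' t, ENNReal.ofReal (Y (t + m) ω)}
        ≤ η * ∑' t, μ {ω | x < Y t ω})
    {η : ℝ≥0∞} (hη : 0 < η) :
    ∀ᶠ x in atTop, μ {ω | ENNReal.ofReal x < ∑' t, ENNReal.ofReal (Y t ω)}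
      ≤ (1 + η) * ∑' t, μ {ω | x < Y t ω} := by
  set R : ℝ → ℝ≥0∞ := fun x => ∑' t, μ {ω | x < Y t ω} with hR
  have hη3 : 0 < η / 3 := ENNReal.div_pos hη.ne' (by simp)
  obtain ⟨δ, hδ0, hδ2, hδ⟩ : ∃ δ : ℝ, 0 < δ ∧ δ < 1 / 2 ∧
      ENNReal.ofReal ((1 - 2 * δ) ^ (-α)) < 1 + η / 3 := by
    have hc : ContinuousAt (fun δ : ℝ => ENNReal.ofReal ((1 - 2 * δ) ^ (-α))) 0 := by
      refine ENNReal.continuous_ofReal.continuousAt.comp ?_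
      exact ContinuousAt.rpow_const (by fun_prop) (Or.inl (by norm_num))
    have h1 : ENNReal.ofReal ((1 - 2 * (0 : ℝ)) ^ (-α)) < 1 + η / 3 := by
      simpa using ENNReal.lt_add_right ENNReal.one_ne_top hη3.ne'
    have h2 := (hc.eventually (gt_mem_nhds h1)).filter_mono (nhdsWithin_le_nhds (s := Set.Ioi 0))
    have h3 : ∀ᶠ δ : ℝ in 𝓝[>] 0, δ ∈ Set.Ioo (0 : ℝ) (1 / 2) :=
      Ioo_mem_nhdsGT (by norm_num)
    obtain ⟨δ, h4, h5⟩ := (h2.and h3).exists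
    exact ⟨δ, h5.1, h5.2, h4⟩
  obtain ⟨η', hη', hscale⟩ := hreg.eventually_comp_mul_le hδ0 hη3
  obtain ⟨m, hm, hT⟩ := htail η' hη'
  have hpairs : Negligible (fun x => ∑ t ∈ Finset.range m, ∑ s ∈ Finset.range t,
      μ {ω | δ / m * x < Y s ω ∧ δ / m * x < Y t ω}) R :=
    Negligible.finset_sum fun t _ => Negligible.finset_sum fun s hs =>
      hreg.negligible_comp_mul (κ := δ / m) (by positivity) (hpair s t (Finset.mem_range.1 hs).ne)
  filter_upwards [hreg.eventually_le_mul (by linarith) hδ, hpairs _ hη3, hscale _ hT,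
    eventually_gt_atTop 0] with x h1 h2 h3 hx
  have hsub : {ω | ENNReal.ofReal x < ∑' t, ENNReal.ofReal (Y t ω)} ⊆
      (⋃ t ∈ Finset.range m, {ω | (1 - 2 * δ) * x < Y t ω}) ∪
      (⋃ t ∈ Finset.range m, ⋃ s ∈ Finset.range t,
        {ω | δ / m * x < Y s ω ∧ δ / m * x < Y t ω}) ∪
      {ω | ENNReal.ofReal (δ * x) < ∑' t, ENNReal.ofReal (Y (t + m) ω)} := by
    intro ω hω
    have hlt : ∀ {a b : ℝ}, ENNReal.ofReal a < ENNReal.ofReal b → a < b := fun h =>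
      (ENNReal.ofReal_lt_ofReal_iff'.1 h).1
    rcases lt_tsum_trichotomy hm hx hδ0 hδ2 hω with ⟨t, ht, h⟩ | ⟨t, ht, s, hs, h, h'⟩ | h
    · exact Or.inl (Or.inl (Set.mem_biUnion (Finset.mem_coe.2 (Finset.mem_range.2 ht)) (hlt h)))
    · refine Or.inl (Or.inr (Set.mem_biUnion (Finset.mem_coe.2 (Finset.mem_range.2 ht))
        (Set.mem_biUnion (Finset.mem_coe.2 (Finset.mem_range.2 hs)) ⟨hlt h, hlt h'⟩)))
    · exact Or.inr h
  calc _ ≤ _ := measure_mono hsub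
    _ ≤ ∑ t ∈ Finset.range m, μ {ω | (1 - 2 * δ) * x < Y t ω} +
        ∑ t ∈ Finset.range m, ∑ s ∈ Finset.range t,
          μ {ω | δ / m * x < Y s ω ∧ δ / m * x < Y t ω} +
        μ {ω | ENNReal.ofReal (δ * x) < ∑' t, ENNReal.ofReal (Y (t + m) ω)} := by
      refine (measure_union_le _ _).trans (add_le_add_left ((measure_union_le _ _).trans
        (add_le_add (measure_biUnion_finset_le _ _) ?_)) _)
      exact (measure_biUnion_finset_le _ _).trans
        (Finset.sum_le_sum fun t _ => measure_biUnion_finset_le _ _)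
    _ ≤ (1 + η / 3) * R x + η / 3 * R x + η / 3 * R x := by
      gcongr
      exact (ENNReal.sum_le_tsum _).trans h1
    _ = (1 + (η / 3 + η / 3 + η / 3)) * R x := by ring
    _ = (1 + η) * R x := by rw [ENNReal.add_thirds]

/-- One exceeding term makes the whole series exceed. Bonferroni on the first `m` terms costs only
joint exceedances, and the remaining tails are small by `htail`. -/
lemma eventually_le_measure_tsum_add (hY : ∀ t, Measurable (Y t))
    (hpair : ∀ s t, s ≠ t → Negligible (fun x => μ {ω | x < Y s ω ∧ x < Y t ω})
      (fun x => ∑' t, μ {ω | x < Y t ω}))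
    (htail : ∀ η : ℝ≥0∞, 0 < η → ∃ m : ℕ, ∀ᶠ x in atTop,
      ∑' t, μ {ω | x < Y (t + m) ω} ≤ η * ∑' t, μ {ω | x < Y t ω})
    {η : ℝ≥0∞} (hη : 0 < η) :
    ∀ᶠ x in atTop, ∑' t, μ {ω | x < Y t ω} ≤
      μ {ω | ENNReal.ofReal x < ∑' t, ENNReal.ofReal (Y t ω)} +
        η * ∑' t, μ {ω | x < Y t ω} := by
  have hη2 : 0 < η / 2 := ENNReal.half_pos hη.ne'
  obtain ⟨m, hT⟩ := htail _ hη2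
  have hpairs : Negligible (fun x => ∑ t ∈ Finset.range m, ∑ s ∈ Finset.range t,
      μ {ω | x < Y s ω ∧ x < Y t ω}) (fun x => ∑' t, μ {ω | x < Y t ω}) :=
    Negligible.finset_sum fun t _ => Negligible.finset_sum fun s hs =>
      hpair s t (Finset.mem_range.1 hs).ne
  filter_upwards [hT, hpairs _ hη2, eventually_gt_atTop 0] with x h1 h2 hx
  have hsub : (⋃ t ∈ Finset.range m, {ω | x < Y t ω}) ⊆
      {ω | ENNReal.ofReal x < ∑' t, ENNReal.ofReal (Y t ω)} := by
    refine Set.iUnion₂_subset fun t _ ω hω => ?_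
    have hω' : x < Y t ω := hω
    exact ((ENNReal.ofReal_lt_ofReal_iff (hx.trans hω')).2 hω').trans_le
      (ENNReal.le_tsum (f := fun t => ENNReal.ofReal (Y t ω)) t)
  have hB := sum_measure_le_measure_iUnion_add (μ := μ) (A := fun t => {ω | x < Y t ω})
    (fun t => measurableSet_lt measurable_const (hY t)) m
  calc ∑' t, μ {ω | x < Y t ω}
      = ∑ t ∈ Finset.range m, μ {ω | x < Y t ω} + ∑' t, μ {ω | x < Y (t + m) ω} :=
        (ENNReal.summable.sum_add_tsum_nat_add' (f := fun t => μ {ω | x < Y t ω}) (k := m)).symm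
    _ ≤ (μ {ω | ENNReal.ofReal x < ∑' t, ENNReal.ofReal (Y t ω)} +
        η / 2 * ∑' t, μ {ω | x < Y t ω}) + η / 2 * ∑' t, μ {ω | x < Y t ω} :=
        add_le_add (hB.trans (add_le_add (measure_mono hsub) h2)) h1
    _ = _ := by rw [add_assoc, ← add_mul, ENNReal.add_halves]

end SumOfTails

lemma Real.rpow_le_rpow_add_rpow {v a b c : ℝ} (hv : 0 < v) (hab : a ≤ b) (hbc : b ≤ c) :
    v ^ b ≤ v ^ c + v ^ a := by
  rcases le_total 1 v with h | h
  · exact (Real.rpow_le_rpow_of_exponent_le h hbc).trans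
      (le_add_of_nonneg_right (by positivity))
  · exact (Real.rpow_le_rpow_of_exponent_ge hv h hab).trans
      (le_add_of_nonneg_left (by positivity))

/-! ### Random weights: moments and products. -/

section Weights

variable {Ω : Type*} [MeasurableSpace Ω] {μ : Measure Ω}

lemma lintegral_moments_mono {T : Ω → ℝ} (hT : ∀ᵐ ω ∂μ, 0 < T ω) {α ε ε' : ℝ} (hε : 0 ≤ ε)
    (h : ε ≤ ε') :
    ∫⁻ ω, ENNReal.ofReal (T ω ^ (α + ε) + T ω ^ (α - ε)) ∂μ ≤
      2 * ∫⁻ ω, ENNReal.ofReal (T ω ^ (α + ε') + T ω ^ (α - ε')) ∂μ := by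
  rw [← lintegral_const_mul' _ _ (by simp)]
  refine lintegral_mono_ae ?_
  filter_upwards [hT] with ω hω
  rw [← ENNReal.ofReal_ofNat, ← ENNReal.ofReal_mul (by norm_num)]
  refine ENNReal.ofReal_le_ofReal ?_
  rw [two_mul]
  exact add_le_add (Real.rpow_le_rpow_add_rpow hω (by linarith) (by linarith))
    (Real.rpow_le_rpow_add_rpow hω (by linarith) (by linarith))

/-- Unifies the two RW cases and creates the strict gap `α + ε < p`. For `α < 1`, `p = 1` and `ε` is
shrunk until `α + ε < 1`; for `α ≥ 1`, `p` is the original `α + ε` and `ε` is halved. -/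
lemma RWCondition.exists_moments {Θ : ℕ → Ω → ℝ} {α : ℝ} (h : RWCondition μ Θ α)
    (hΘ : ∀ t, ∀ᵐ ω ∂μ, 0 < Θ t ω) :
    ∃ ε p : ℝ, 0 < ε ∧ ε < α ∧ 1 ≤ p ∧ α + ε < p ∧
      ∑' t, (∫⁻ ω, ENNReal.ofReal (Θ t ω ^ (α + ε) + Θ t ω ^ (α - ε)) ∂μ) ^ (1 / p) ≠ ∞ := by
  rcases lt_or_ge α 1 with hα | hα
  · obtain ⟨ε, hε, hεα, hsum⟩ := h.1 hα
    have h1 := min_le_left ε ((1 - α) / 2)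
    have h2 := min_le_right ε ((1 - α) / 2)
    have h3 : 0 < min ε ((1 - α) / 2) := lt_min hε (by linarith)
    refine ⟨min ε ((1 - α) / 2), 1, h3, by linarith, le_rfl, by linarith, ?_⟩
    simp only [div_one, ENNReal.rpow_one]
    refine ne_top_of_le_ne_top (ENNReal.mul_ne_top ENNReal.ofNat_ne_top hsum.ne)
      (b := 2 * _) ?_
    rw [← ENNReal.tsum_mul_left]
    exact ENNReal.tsum_le_tsum fun t => lintegral_moments_mono (hΘ t) h3.le h1
  · obtain ⟨ε, hε, hεα, hsum⟩ := h.2 hα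
    refine ⟨ε / 2, α + ε, by linarith, by linarith, by linarith, by linarith, ?_⟩
    have hp : 0 ≤ 1 / (α + ε) := by positivity
    refine ne_top_of_le_ne_top (ENNReal.mul_ne_top
      (ENNReal.rpow_ne_top_of_nonneg hp ENNReal.ofNat_ne_top) hsum.ne)
      (b := 2 ^ (1 / (α + ε)) * _) ?_
    rw [← ENNReal.tsum_mul_left]
    refine ENNReal.tsum_le_tsum fun t => ?_
    rw [← ENNReal.mul_rpow_of_nonneg _ _ hp]
    gcongr
    exact lintegral_moments_mono (hΘ t) (by linarith) (by linarith)

variable [IsProbabilityMeasure μ] {X T : Ω → ℝ}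

/-- Choose `c` with `P[T > c] > 0`. By independence the event `T > c`, `X > x` has probability `P[T
> c] * P[X > x]`, and it forces `T * X > c * x`. -/
lemma exists_measure_lt_le_mul_measure_lt_mul
    (hTpos : ∀ᵐ ω ∂μ, 0 < T ω) (hTX : IndepFun T X μ) :
    ∃ c : ℝ, 0 < c ∧ ∃ K : ℝ≥0∞, K ≠ ∞ ∧
      ∀ x : ℝ, 0 < x → μ {ω | x < X ω} ≤ K * μ {ω | c * x < T ω * X ω} := by
  obtain ⟨n, hn⟩ : ∃ n : ℕ, μ {ω | 1 / ((n : ℝ) + 1) < T ω} ≠ 0 := by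
    by_contra! hc
    have h0 : μ (⋃ n : ℕ, {ω | 1 / ((n : ℝ) + 1) < T ω}) = 0 := measure_iUnion_null hc
    have h1 : ∀ᵐ ω ∂μ, False := by
      filter_upwards [hTpos, measure_eq_zero_iff_ae_notMem.1 h0] with ω hω hω'
      obtain ⟨n, hn⟩ := exists_nat_one_div_lt hω
      exact hω' (Set.mem_iUnion.2 ⟨n, hn⟩)
    exact IsProbabilityMeasure.ne_zero μ (by simpa using h1)
  have hc : (0 : ℝ) < 1 / ((n : ℝ) + 1) := by positivity
  set c : ℝ := 1 / ((n : ℝ) + 1)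
  refine ⟨c, hc, (μ {ω | c < T ω})⁻¹, ENNReal.inv_ne_top.2 hn, fun x hx => ?_⟩
  have hind : μ ({ω | c < T ω} ∩ {ω | x < X ω}) = μ {ω | c < T ω} * μ {ω | x < X ω} :=
    hTX.measure_inter_preimage_eq_mul (Set.Ioi c) (Set.Ioi x) measurableSet_Ioi measurableSet_Ioi
  calc μ {ω | x < X ω} = (μ {ω | c < T ω})⁻¹ * (μ {ω | c < T ω} * μ {ω | x < X ω}) := by
        rw [← mul_assoc, ENNReal.inv_mul_cancel hn (measure_ne_top _ _), one_mul]
    _ ≤ _ := by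
        rw [← hind]
        gcongr
        rintro ω ⟨h1, h2⟩
        exact mul_lt_mul'' h1 h2 hc.le hx.le

lemma measure_mem_and_lt_mul_le (hT : Measurable T) (hX : Measurable X)
    (hTpos : ∀ᵐ ω ∂μ, 0 < T ω) (hTX : IndepFun T X μ) {a b x : ℝ} {M : ℝ≥0∞} (hM : M ≠ ∞)
    (hbound : ∀ v : ℝ, 0 < v →
      μ {ω | x / v < X ω} ≤ M * ENNReal.ofReal (v ^ a + v ^ b)) {B : Set ℝ}
    (hB : MeasurableSet B) :
    μ {ω | T ω ∈ B ∧ x < T ω * X ω} ≤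
      M * ∫⁻ ω in T ⁻¹' B, ENNReal.ofReal (T ω ^ a + T ω ^ b) ∂μ := by
  rw [measure_mem_and_lt_mul hT hX hTpos hTX hB, ← lintegral_const_mul' _ _ hM]
  refine lintegral_mono_ae (ae_restrict_of_ae ?_)
  filter_upwards [hTpos] with ω hω using hbound _ hω

/-- Since `x * z / v = x / (v / z)`, the level `x * z`, possibly far below the Potter threshold, is
handled by rescaling the weight while `x` stays fixed. For `z ≤ 1` the worse of the two powers of
`z` is `z ^ (-a)`. -/
lemma measure_mul_lt_mul_le (hT : Measurable T) (hX : Measurable X)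
    (hTpos : ∀ᵐ ω ∂μ, 0 < T ω) (hTX : IndepFun T X μ) {a b x : ℝ} (hba : b ≤ a) {M : ℝ≥0∞}
    (hM : M ≠ ∞) (hbound : ∀ v : ℝ, 0 < v →
      μ {ω | x / v < X ω} ≤ M * ENNReal.ofReal (v ^ a + v ^ b)) {z : ℝ} (hz : 0 < z)
    (hz1 : z ≤ 1) :
    μ {ω | x * z < T ω * X ω} ≤
      M * (∫⁻ ω, ENNReal.ofReal (T ω ^ a + T ω ^ b) ∂μ) * ENNReal.ofReal (z ^ (-a)) := by
  have h := measure_mem_and_lt_mul_le hT hX hTpos hTX (a := a) (b := b) (x := x * z)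
    (M := M * ENNReal.ofReal (z ^ (-a))) (ENNReal.mul_ne_top hM ENNReal.ofReal_ne_top)
    (fun v hv => ?_) MeasurableSet.univ
  · simp only [Set.mem_univ, true_and, Set.preimage_univ, Measure.restrict_univ] at h
    refine h.trans_eq (by ring)
  · have e : x * z / v = x / (v / z) := by field_simp
    rw [e, mul_assoc, ← ENNReal.ofReal_mul (by positivity)]
    refine (hbound _ (by positivity)).trans ?_
    gcongr
    rw [Real.div_rpow hv.le hz.le, Real.div_rpow hv.le hz.le, div_eq_mul_inv, div_eq_mul_inv,
      ← Real.rpow_neg hz.le, ← Real.rpow_neg hz.le, mul_comm (v ^ a),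
      mul_comm (v ^ b), mul_add]
    refine add_le_add le_rfl (mul_le_mul_of_nonneg_right ?_ (by positivity))
    exact Real.rpow_le_rpow_of_exponent_ge hz hz1 (by linarith)

lemma exists_setLIntegral_Ioi_le (hT : Measurable T) {f : Ω → ℝ≥0∞} (hf : ∫⁻ ω, f ω ∂μ ≠ ∞)
    {C η : ℝ≥0∞} (hC : C ≠ ∞) (hη : 0 < η) :
    ∃ K₀ : ℝ, ∀ K, K₀ ≤ K → C * ∫⁻ ω in T ⁻¹' Set.Ioi K, f ω ∂μ ≤ η := by
  have hanti : Antitone fun K : ℝ => T ⁻¹' Set.Ioi K := fun a b hab =>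
    Set.preimage_mono (Set.Ioi_subset_Ioi hab)
  have h1 : Tendsto (fun K : ℝ => μ (T ⁻¹' Set.Ioi K)) atTop (𝓝 0) := by
    have := tendsto_measure_iInter_atTop (μ := μ)
      (fun K => (hT measurableSet_Ioi).nullMeasurableSet) hanti ⟨0, measure_ne_top _ _⟩
    have e : (⋂ K : ℝ, T ⁻¹' Set.Ioi K) = ∅ := by
      ext ω
      simp only [Set.mem_iInter, Set.mem_preimage, Set.mem_Ioi, Set.mem_empty_iff_false,
        iff_false, not_forall, not_lt]
      exact ⟨T ω, le_rfl⟩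
    rwa [e, measure_empty] at this
  have h2 := ENNReal.Tendsto.const_mul (tendsto_setLIntegral_zero hf h1) (Or.inr hC)
  rw [mul_zero] at h2
  exact eventually_atTop.1 ((h2.eventually (gt_mem_nhds hη)).mono fun _ h => h.le)

/-- Joint exceedances of two products with asymptotically independent factors are negligible. -/
lemma negligible_measure_lt_mul_and_lt_mul {X' T' : Ω → ℝ} {α ε x₁ : ℝ} {C : ℝ≥0∞} {R : ℝ → ℝ≥0∞}
    (hT : Measurable T) (hX : Measurable X) (hT' : Measurable T') (hX' : Measurable X')
    (hTpos : ∀ᵐ ω ∂μ, 0 < T ω) (hTpos' : ∀ᵐ ω ∂μ, 0 < T' ω)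
    (hTX : IndepFun T X μ) (hTX' : IndepFun T' X' μ)
    (hw : ∫⁻ ω, ENNReal.ofReal (T ω ^ (α + ε) + T ω ^ (α - ε)) ∂μ ≠ ∞)
    (hw' : ∫⁻ ω, ENNReal.ofReal (T' ω ^ (α + ε) + T' ω ^ (α - ε)) ∂μ ≠ ∞)
    (hC : C ≠ ∞) (hRtop : ∀ x, x₁ ≤ x → R x ≠ ∞)
    (hbound : ∀ x v : ℝ, 0 < v → x₁ ≤ x →
      μ {ω | x / v < X ω} ≤ C * R x * ENNReal.ofReal (v ^ (α + ε) + v ^ (α - ε)))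
    (hbound' : ∀ x v : ℝ, 0 < v → x₁ ≤ x →
      μ {ω | x / v < X' ω} ≤ C * R x * ENNReal.ofReal (v ^ (α + ε) + v ^ (α - ε)))
    (hasymp : AsymptoticallyIndependent μ X X') :
    Negligible (fun x => μ {ω | x < T ω * X ω ∧ x < T' ω * X' ω}) R := by
  intro η hη
  have hη3 : 0 < η / 3 := ENNReal.div_pos hη.ne' (by simp)
  obtain ⟨K₁, hK₁⟩ := exists_setLIntegral_Ioi_le hT hw hC hη3
  obtain ⟨K₂, hK₂⟩ := exists_setLIntegral_Ioi_le hT' hw' hC hη3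
  set K := max (max K₁ K₂) 1 with hK
  have hK0 : 0 < K := lt_of_lt_of_le one_pos (le_max_right _ _)
  have hb₁ := hK₁ K ((le_max_left _ _).trans (le_max_left _ _))
  have hb₂ := hK₂ K ((le_max_right _ _).trans (le_max_left _ _))
  set D := C * ENNReal.ofReal (K ^ (α + ε) + K ^ (α - ε)) with hD
  have hDtop : D ≠ ∞ := ENNReal.mul_ne_top hC ENNReal.ofReal_ne_top
  -- Adding 1 avoids dividing by a possibly zero `D`.
  have hD1 : D + 1 ≠ ∞ := by simp [hDtop]
  have hη' : 0 < η / 3 / (D + 1) := ENNReal.div_pos hη3.ne' hD1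
  have hlim := (hasymp.2.1.comp (tendsto_id.atTop_div_const hK0)).eventually (gt_mem_nhds hη')
  filter_upwards [hlim, eventually_gt_atTop 0, eventually_ge_atTop x₁] with x h1 hx hx₁
  have hxK : 0 < x / K := by positivity
  have hM : C * R x ≠ ∞ := ENNReal.mul_ne_top hC (hRtop x hx₁)
  have e1 : μ {ω | T ω ∈ Set.Ioi K ∧ x < T ω * X ω} ≤ η / 3 * R x :=
    (measure_mem_and_lt_mul_le hT hX hTpos hTX hM (fun v hv => hbound x v hv hx₁)
      measurableSet_Ioi).trans (by rw [mul_right_comm]; gcongr)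
  have e2 : μ {ω | T' ω ∈ Set.Ioi K ∧ x < T' ω * X' ω} ≤ η / 3 * R x :=
    (measure_mem_and_lt_mul_le hT' hX' hTpos' hTX' hM (fun v hv => hbound' x v hv hx₁)
      measurableSet_Ioi).trans (by rw [mul_right_comm]; gcongr)
  have e3 : μ {ω | x / K < X ω ∧ x / K < X' ω} ≤ η / 3 * R x := by
    have h2 := (ENNReal.div_le_iff (hasymp.1 _ hxK).1.ne' (measure_ne_top _ _)).1 h1.le
    calc _ ≤ η / 3 / (D + 1) * μ {ω | x / K < X ω} := h2
      _ ≤ η / 3 / (D + 1) * ((D + 1) * R x) := by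
          gcongr
          refine (hbound x K hK0 hx₁).trans ?_
          rw [mul_right_comm]
          gcongr
          exact le_self_add
      _ = η / 3 * R x := by rw [← mul_assoc, ENNReal.div_mul_cancel (by simp) hD1]
  have hsub : ({ω | x < T ω * X ω ∧ x < T' ω * X' ω} : Set Ω) ≤ᵐ[μ]
      (({ω | T ω ∈ Set.Ioi K ∧ x < T ω * X ω} ∪ {ω | T' ω ∈ Set.Ioi K ∧ x < T' ω * X' ω}) ∪
        {ω | x / K < X ω ∧ x / K < X' ω} : Set Ω) := by
    have aux : ∀ {a b : ℝ}, 0 < a → a ≤ K → x < a * b → x / K < b := fun {a b} ha haK hab => by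
      have hb : 0 < b := pos_of_mul_pos_right (hx.trans hab) ha.le
      rw [div_lt_iff₀ hK0]
      nlinarith
    filter_upwards [hTpos, hTpos'] with ω hω hω' ⟨h3, h4⟩
    rcases lt_or_ge K (T ω) with h5 | h5
    · exact Or.inl (Or.inl ⟨h5, h3⟩)
    rcases lt_or_ge K (T' ω) with h6 | h6
    · exact Or.inl (Or.inr ⟨h6, h4⟩)
    exact Or.inr ⟨aux hω h5 h3, aux hω' h6 h4⟩
  calc _ ≤ _ := measure_mono_ae hsub
    _ ≤ η / 3 * R x + η / 3 * R x + η / 3 * R x :=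
      (measure_union_le _ _).trans (add_le_add ((measure_union_le _ _).trans (add_le_add e1 e2)) e3)
    _ = η * R x := by rw [← add_mul, ← add_mul, ENNReal.add_thirds]

end Weights

/-! ### Remainders of the series and the conclusion. -/

/-- Markov for the `p`-th power of the truncated sum, then Minkowski, then the layer-cake bound
termwise. No independence between the terms is needed. -/
lemma measure_lt_tsum_le {Ω : Type*} [MeasurableSpace Ω] {μ : Measure Ω} {Y : ℕ → Ω → ℝ}
    (hY : ∀ t, Measurable (Y t)) {p β x : ℝ} (hp : 1 ≤ p) (hx : 0 < x) {M : ℝ≥0∞} {w : ℕ → ℝ≥0∞}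
    (h : ∀ t z, 0 < z → z < 1 →
      μ {ω | x * z < Y t ω} ≤ M * w t * ENNReal.ofReal (z ^ (-β))) :
    μ {ω | ENNReal.ofReal x < ∑' t, ENNReal.ofReal (Y t ω)} ≤
      ENNReal.ofReal p * (∫⁻ z in Set.Ioo (0 : ℝ) 1, ENNReal.ofReal (z ^ (p - 1 - β))) * M *
        (∑' t, w t ^ (1 / p)) ^ p := by
  have hp0 : 0 < p := by linarith
  set D := ENNReal.ofReal p * ∫⁻ z in Set.Ioo (0 : ℝ) 1, ENNReal.ofReal (z ^ (p - 1 - β)) with hD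
  have hmeas : ∀ t, Measurable fun ω => ENNReal.ofReal (max 0 (min (Y t ω / x) 1)) := fun t => by
    have := hY t
    fun_prop
  calc μ {ω | ENNReal.ofReal x < ∑' t, ENNReal.ofReal (Y t ω)}
      ≤ μ {ω | 1 ≤ (∑' t, ENNReal.ofReal (max 0 (min (Y t ω / x) 1))) ^ p} := by
        refine measure_mono fun ω hω => ?_
        have := ENNReal.rpow_le_rpow (one_le_tsum_truncated hx hω) hp0.le
        rwa [ENNReal.one_rpow] at this
    _ ≤ ∫⁻ ω, (∑' t, ENNReal.ofReal (max 0 (min (Y t ω / x) 1))) ^ p ∂μ := by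
        have hm : Measurable fun ω => (∑' t, ENNReal.ofReal (max 0 (min (Y t ω / x) 1))) ^ p :=
          (Measurable.tsum hmeas).pow_const p
        simpa using mul_meas_ge_le_lintegral (μ := μ) hm 1
    _ ≤ (∑' t, (∫⁻ ω, ENNReal.ofReal (max 0 (min (Y t ω / x) 1)) ^ p ∂μ) ^ (1 / p)) ^ p :=
        lintegral_tsum_rpow_le hmeas hp
    _ ≤ (∑' t, (D * M * w t) ^ (1 / p)) ^ p := by
        gcongr with t
        rw [mul_assoc D]
        exact lintegral_truncated_rpow_le (hY t) hp hx (h t)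
    _ = D * M * (∑' t, w t ^ (1 / p)) ^ p := by
        simp_rw [ENNReal.mul_rpow_of_nonneg (D * M) _ (by positivity : 0 ≤ 1 / p)]
        rw [ENNReal.tsum_mul_left, ENNReal.mul_rpow_of_nonneg _ _ hp0.le, ← ENNReal.rpow_mul,
          one_div_mul_cancel hp0.ne', ENNReal.rpow_one]

lemma ae_lt_top_of_tendsto_measure {Ω : Type*} [MeasurableSpace Ω] {μ : Measure Ω} {S : Ω → ℝ≥0∞}
    (h : Tendsto (fun x : ℝ => μ {ω | ENNReal.ofReal x < S ω}) atTop (𝓝 0)) :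
    ∀ᵐ ω ∂μ, S ω < ∞ := by
  rw [ae_iff]
  refine le_antisymm (ge_of_tendsto' h fun x => measure_mono fun ω hω => ?_) zero_le
  exact ENNReal.ofReal_lt_top.trans_le (not_lt.1 hω)

theorem mainTheorem6 {Ω : Type*} [MeasurableSpace Ω] (μ : Measure Ω) [IsProbabilityMeasure μ]
    (X Θ : ℕ → Ω → ℝ) (α : ℝ) (hα : 0 < α)
    (hXmeas : ∀ t, Measurable (X t)) (hΘmeas : ∀ t, Measurable (Θ t))
    (hXpos : ∀ t, ∀ᵐ ω ∂μ, 0 < X t ω) (hΘpos : ∀ t, ∀ᵐ ω ∂μ, 0 < Θ t ω)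
    (hXident : ∀ s t, IdentDistrib (X s) (X t) μ μ)
    (hXasymp : ∀ s t, s ≠ t → AsymptoticallyIndependent μ (X s) (X t))
    (hindep : IndepFun (fun ω t => Θ t ω) (fun ω t => X t ω) μ)
    (hRW : RWCondition μ Θ α)
    (hreg : IsRegularlyVarying (tailSum μ Θ X) (-α)) :
    TailEquivalent (tailSum μ Θ X) (fun x => μ {ω | ENNReal.ofReal x < weightedSeries Θ X ω}) ∧
      ∀ᵐ ω ∂μ, weightedSeries Θ X ω < ∞ := by
  obtain ⟨ε, p, hε, hεα, hp, hpα, hsum⟩ := hRW.exists_moments hΘpos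
  have hp0 : 0 < p := by linarith
  have hind : ∀ t, IndepFun (Θ t) (X t) μ := fun t =>
    hindep.comp (measurable_pi_apply t) (measurable_pi_apply t)
  have hYmeas : ∀ t, Measurable fun ω => Θ t ω * X t ω := fun t => (hΘmeas t).mul (hXmeas t)
  have hanti : Antitone (tailSum μ Θ X) := fun x y hxy =>
    ENNReal.tsum_le_tsum fun t => measure_mono fun ω hω => lt_of_le_of_lt hxy hω
  have hF : ∀ t x, μ {ω | x < X t ω} = μ {ω | x < X 0 ω} := fun t x =>
    (hXident t 0).measure_mem_eq (s := Set.Ioi x) measurableSet_Ioi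
  obtain ⟨c, hc, K, hK, hFK⟩ := exists_measure_lt_le_mul_measure_lt_mul (hΘpos 0) (hind 0)
  have hFR : ∀ᶠ x in atTop, μ {ω | x < X 0 ω} ≤
      K * (ENNReal.ofReal (c ^ (-α)) + 1) * tailSum μ Θ X x := by
    filter_upwards [eventually_gt_atTop 0, hreg.eventually_le_mul hc
      (ENNReal.lt_add_right ENNReal.ofReal_ne_top one_ne_zero)] with x hx h1
    rw [mul_assoc]
    refine (hFK x hx).trans ?_
    gcongr
    exact (ENNReal.le_tsum (f := fun t => μ {ω | c * x < Θ t ω * X t ω}) 0).trans h1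
  obtain ⟨C, hC, x₁, hx₁, hbound⟩ := hreg.potter_of_le hanti hε hεα (fun x => prob_le_one)
    (ENNReal.mul_ne_top hK (by simp)) hFR
  obtain ⟨x₂, hx₂⟩ := eventually_atTop.1 hreg.1
  have hbound' : ∀ t x v, 0 < v → max x₁ x₂ ≤ x → μ {ω | x / v < X t ω} ≤
      C * tailSum μ Θ X x * ENNReal.ofReal (v ^ (α + ε) + v ^ (α - ε)) := fun t x v hv hx => by
    rw [hF]; exact hbound x v hv ((le_max_left _ _).trans hx)
  have hRtop : ∀ x, max x₁ x₂ ≤ x → tailSum μ Θ X x ≠ ∞ := fun x hx =>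
    (hx₂ x ((le_max_right _ _).trans hx)).2.ne
  set w : ℕ → ℝ≥0∞ := fun t =>
    ∫⁻ ω, ENNReal.ofReal (Θ t ω ^ (α + ε) + Θ t ω ^ (α - ε)) ∂μ with hw
  have hwtop : ∀ t, w t ≠ ∞ := fun t ht => by
    have h1 : w t ^ (1 / p) ≠ ∞ := ENNReal.ne_top_of_tsum_ne_top hsum t
    exact h1 (by rw [ht]; exact ENNReal.top_rpow_of_pos (by positivity))
  have hY : ∀ x, max x₁ x₂ ≤ x → ∀ t z, 0 < z → z ≤ 1 → μ {ω | x * z < Θ t ω * X t ω} ≤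
      C * tailSum μ Θ X x * w t * ENNReal.ofReal (z ^ (-(α + ε))) := fun x hx t z hz hz1 =>
    measure_mul_lt_mul_le (hΘmeas t) (hXmeas t) (hΘpos t) (hind t) (by linarith)
      (ENNReal.mul_ne_top hC (hRtop x hx)) (fun v hv => hbound' t x v hv hx) hz hz1
  have hpair : ∀ s t, s ≠ t → Negligible
      (fun x => μ {ω | x < Θ s ω * X s ω ∧ x < Θ t ω * X t ω}) (tailSum μ Θ X) := fun s t hst =>
    negligible_measure_lt_mul_and_lt_mul (hΘmeas s) (hXmeas s) (hΘmeas t) (hXmeas t) (hΘpos s)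
      (hΘpos t) (hind s) (hind t) (hwtop s) (hwtop t) hC hRtop (hbound' s) (hbound' t)
      (hXasymp s t hst)
  have htail : ∀ η : ℝ≥0∞, 0 < η → ∃ m : ℕ, 0 < m ∧ ∀ᶠ x in atTop,
      μ {ω | ENNReal.ofReal x < ∑' t, ENNReal.ofReal (Θ (t + m) ω * X (t + m) ω)}
        ≤ η * tailSum μ Θ X x ∧
      ∑' t, μ {ω | x < Θ (t + m) ω * X (t + m) ω} ≤ η * tailSum μ Θ X x := by
    intro η hη
    set D := ENNReal.ofReal p *
      ∫⁻ z in Set.Ioo (0 : ℝ) 1, ENNReal.ofReal (z ^ (p - 1 - (α + ε))) with hD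
    have hDtop : D ≠ ∞ := ENNReal.mul_ne_top ENNReal.ofReal_ne_top
      (lintegral_Ioo_rpow_ne_top (by linarith))
    -- In `D + 1`, the `D` pays for the remainder of the series and the 1 for the remainder of the
    -- sum of tails, so one `m` serves both.
    have hlim : Tendsto (fun m : ℕ => (D + 1) * C * (∑' t, w (t + m) ^ (1 / p)) ^ p) atTop
        (𝓝 0) := by
      have h1 := ((ENNReal.continuous_rpow_const (y := p)).tendsto 0).comp
        (ENNReal.tendsto_sum_nat_add (fun t => w t ^ (1 / p)) hsum)
      rw [ENNReal.zero_rpow_of_pos hp0] at h1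
      simpa using ENNReal.Tendsto.const_mul h1
        (Or.inr (ENNReal.mul_ne_top (ENNReal.add_ne_top.2 ⟨hDtop, ENNReal.one_ne_top⟩) hC))
    obtain ⟨m, hm, hm0⟩ := ((hlim.eventually (gt_mem_nhds hη)).and (eventually_gt_atTop 0)).exists
    refine ⟨m, hm0, ?_⟩
    filter_upwards [eventually_ge_atTop (max x₁ x₂)] with x hx
    have hx0 : 0 < x := hx₁.trans_le ((le_max_left _ _).trans hx)
    constructor
    · refine (measure_lt_tsum_le (fun t => hYmeas (t + m)) hp hx0
        (fun t z hz hz1 => hY x hx (t + m) z hz hz1.le)).trans ?_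
      rw [← hD]
      calc D * (C * tailSum μ Θ X x) * (∑' t, w (t + m) ^ (1 / p)) ^ p
          = D * C * (∑' t, w (t + m) ^ (1 / p)) ^ p * tailSum μ Θ X x := by ring
        _ ≤ (D + 1) * C * (∑' t, w (t + m) ^ (1 / p)) ^ p * tailSum μ Θ X x := by
            gcongr
            exact le_self_add
        _ ≤ _ := by gcongr
    · calc _ ≤ ∑' t, C * tailSum μ Θ X x * (w (t + m) ^ (1 / p)) ^ p := by
            refine ENNReal.tsum_le_tsum fun t => ?_
            rw [← ENNReal.rpow_mul, one_div_mul_cancel hp0.ne', ENNReal.rpow_one]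
            simpa using hY x hx (t + m) 1 one_pos le_rfl
        _ ≤ C * tailSum μ Θ X x * (∑' t, w (t + m) ^ (1 / p)) ^ p := by
            rw [ENNReal.tsum_mul_left]
            gcongr
            exact ENNReal.tsum_rpow_le_rpow_tsum _ hp
        _ ≤ ((D + 1) * C * (∑' t, w (t + m) ^ (1 / p)) ^ p) * tailSum μ Θ X x := by
            rw [mul_right_comm C, add_mul, one_mul, add_mul]
            gcongr
            exact le_add_self
        _ ≤ _ := by gcongr
  have hle : ∀ η : ℝ≥0∞, 0 < η → ∀ᶠ x in atTop,
      μ {ω | ENNReal.ofReal x < weightedSeries Θ X ω} ≤ (1 + η) * tailSum μ Θ X x :=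
    fun η hη => eventually_measure_tsum_le (Y := fun t ω => Θ t ω * X t ω) hreg hpair
      (fun η hη => (htail η hη).imp fun m h => ⟨h.1, h.2.mono fun x h => h.1⟩) hη
  have hge : ∀ η : ℝ≥0∞, 0 < η → ∀ᶠ x in atTop, tailSum μ Θ X x ≤
      μ {ω | ENNReal.ofReal x < weightedSeries Θ X ω} + η * tailSum μ Θ X x :=
    fun η hη => eventually_le_measure_tsum_add (Y := fun t ω => Θ t ω * X t ω) hYmeas hpair
      (fun η hη => (htail η hη).imp fun m h => h.2.mono fun x h => h.2) hη
  refine ⟨tailEquivalent_of_le hreg.1 (fun x => measure_lt_top _ _) hle hge,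
    ae_lt_top_of_tendsto_measure ?_⟩
  -- The upper bound with `η = 1` gives `P[X_(∞) > x] ≤ 2 * R x → 0`, hence finiteness almost
  -- surely.
  have h0 := ENNReal.Tendsto.const_mul (a := 1 + 1) (hreg.tendsto_zero hanti hα)
    (Or.inr (by simp))
  rw [mul_zero] at h0
  exact tendsto_of_tendsto_of_tendsto_of_le_of_le' tendsto_const_nhds h0
    (Eventually.of_forall fun x => zero_le) (hle 1 one_pos)
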